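/- Let $1\le k\le d$ be integers and let $w=(w_1,\dots,w_d)\in\mathbb{N}^d$. A $(d,k)$-direction is a subset of $\{1,\dots,d\}$ of cardinality $k$. A non-ambiguous tree (NAT) of dimension $(d,k)$ is a non-empty finite rooted tree, in which the children of each vertex are indexed by pairwise distinct $(d,k)$-directions, with every vertex labelled by an element of $(\mathbb{N}\cup\{\bullet\})^d$, such that: (1) all components of the label of the root are integers, and the label of a child of index $\pi$ has an integer $i$-th component if $i\in\pi$ and $\bullet$ if $i\notin\pi$; (2) if $U$ is a proper descendant of $V$ and the $i$-th components of the labels of $U$ and $V$ are both different from $\bullet$, then that of $V$ is strictly greater than that of $U$; (3) for each $i$, the $i$-th components different from $\bullet$ of the labels of distinct vertices are distinct; (4) for each $i$, the set of the $i$-th components different from $\bullet$ of the labels of all vertices is an interval of integers with minimum $1$. Its geometric size is the label of its root. Its completed labels, which are elements of $\mathbb{N}^d$, are obtained by replacing, in the label of each vertex $U$, each component $i$ equal to $\bullet$ by the $i$-th component of the closest ancestor of $U$ whose $i$-th component is not $\bullet$. For $P\in\mathbb{N}^d$ and a $(d,k)$-direction $\pi$ put $C(P,\pi)=\{P+\sum_{i\in\pi}a_ie_i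 : a_i\in\mathbb{N}\}$, where $(e_1,\dots,e_d)$ is the canonical basis. A geometric non-ambiguous tree of dimension $(d,k)$ and box $w$ is a non-empty set $\mathcal V\subset\mathbb{N}^d$ such that: (a) $\mathcal V\subset\{1,\dots,w_1\}\times\cdots\times\{1,\dots,w_d\}$; (b) $w\in\mathcal V$ (the root); (c) for each $P\in\mathcal V$ with $P\ne w$ there is a unique $(d,k)$-direction $\pi$, called the type of $P$, such that $C(P,\pi)$ contains a point of $\mathcal V$ different from $P$; (d) for each $i\in\{1,\dots,d\}$ and each integer $l$ with $1\le l\le w_i-1$, the hyperplane $\{x_i=l\}$ contains exactly one point of $\mathcal V$ whose type contains $i$; (e) for every $(d,k)$-direction $\pi$ and all distinct $P,P'\in\mathcal V$ with $P_i=P'_i$ for all $i\notin\pi$, either $P_j>P'_j$ for all $j\in\pi$, or $P'_j>P_j$ for all $j\in\pi$. Then the map that sends a NAT to the set of the completed labels of its vertices is a bijection from the set of NATs of dimension $(d,k)$ and geometric size $w$ onto the set of geometric non-ambiguous trees of dimension $(d,k)$ and box $w$. -/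

import Mathlib

namespace NonAmbiguous

/-- A `(d,k)`-direction: a subset of cardinality `k` of the set of the `d` coordinate indices. -/
abbrev Direction (d k : ℕ) : Type := {s : Finset (Fin d) // s.card = k}

/-- A non-empty (finite) rooted tree in which the children of a vertex are indexed by pairwise
distinct `(d,k)`-directions, and whose vertices carry labels in `(ℕ ∪ {•})^d`; the symbol `•` is
`none`.  A vertex is the list of the indices met on the way from it up to the root: `[]` is the
root, and `π :: u` is the child of index `π` of the vertex `u`. -/
structure LabelledTree (d k : ℕ) where
  verts : Finset (List (Direction d k))
  root_mem : [] ∈ verts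
  parent_mem : ∀ {π : Direction d k} {u : List (Direction d k)}, π :: u ∈ verts → u ∈ verts
  label : {u // u ∈ verts} → Fin d → Option ℕ

namespace LabelledTree

variable {d k : ℕ}

/-- The root. -/
def root (T : LabelledTree d k) : {u // u ∈ T.verts} := ⟨[], T.root_mem⟩

/-- `u` is a proper descendant of `v`: the path from `u` to the root goes through `v ≠ u`. -/
def IsDescendant (T : LabelledTree d k) (u v : {u // u ∈ T.verts}) : Prop :=
  u ≠ v ∧ v.1 <:+ u.1

/-- The set of the `i`-th components different from `•` of the labels. -/
def components (T : LabelledTree d k) (i : Fin d) : Set ℕ :=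
  {a | ∃ u : {u // u ∈ T.verts}, T.label u i = some a}

/-- Non-ambiguous trees of dimension `(d,k)`. -/
structure IsNAT (T : LabelledTree d k) : Prop where
  /-- The root is labelled with a `(d,d)`-tuple. -/
  root_label : ∀ i, (T.label T.root i).isSome
  /-- A child of index `π` is labelled with a `(d,k)`-tuple of direction `π`. -/
  child_label : ∀ (π : Direction d k) (u : List (Direction d k)) (h : π :: u ∈ T.verts) (i : Fin d),
    (T.label ⟨π :: u, h⟩ i).isSome ↔ i ∈ π.1
  /-- Components strictly decrease from a vertex to its descendants. -/
  growth : ∀ u v : {u // u ∈ T.verts}, T.IsDescendant u v →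
    ∀ (i : Fin d) (a b : ℕ), T.label u i = some a → T.label v i = some b → a < b
  /-- The `i`-th components different from `•` are pairwise distinct. -/
  distinct : ∀ u v : {u // u ∈ T.verts}, u ≠ v →
    ∀ (i : Fin d) (a b : ℕ), T.label u i = some a → T.label v i = some b → a ≠ b
  /-- The set of the `i`-th components different from `•` is an interval with minimum `1`. -/
  interval : ∀ i, (T.components i).OrdConnected ∧ IsLeast (T.components i) 1

/-- The geometric size of a tree is the tuple of integers that labels its root. -/
def HasGeometricSize (T : LabelledTree d k) (w : Fin d → ℕ) : Prop :=
  ∀ i, T.label T.root i = some (w i)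

/-- The completed label: a component `•` is replaced by the same component of the closest ancestor
for which it is not `•`.  (The value `0` is used only if the root has a component `•`.) -/
def completedLabel (T : LabelledTree d k) :
    (u : List (Direction d k)) → u ∈ T.verts → Fin d → ℕ
  | [], h, i => (T.label ⟨[], h⟩ i).getD 0
  | π :: u, h, i => (T.label ⟨π :: u, h⟩ i).getD (T.completedLabel u (T.parent_mem h) i)

/-- The set of the points of `ℕ^d` given by the completed labels of the vertices. -/
def pointSet (T : LabelledTree d k) : Set (Fin d → ℕ) :=
  {P | ∃ (u : List (Direction d k)) (h : u ∈ T.verts), P = T.completedLabel u h}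

end LabelledTree

/-- The cone of origin `P` and direction `π`: the points `P + ∑_{i ∈ π} a_i e_i` with `a_i ∈ ℕ`. -/
def cone {d k : ℕ} (P : Fin d → ℕ) (π : Direction d k) : Set (Fin d → ℕ) :=
  {Q | ∃ a : Fin d → ℕ, Q = P + ∑ i ∈ π.1, a i • Pi.single i 1}

/-- The cone of origin `P` and direction `π` contains a point of `V` different from `P`.  For a
point `P ≠ w` of a geometric non-ambiguous tree this says that `P` is of type `π`. -/
def IsOfType {d k : ℕ} (V : Set (Fin d → ℕ)) (P : Fin d → ℕ) (π : Direction d k) : Prop :=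
  ∃ Q ∈ V, Q ≠ P ∧ Q ∈ cone P π

/-- Geometric non-ambiguous trees of dimension `(d,k)` and box `w`. -/
structure IsGeometricNAT {d : ℕ} (k : ℕ) (w : Fin d → ℕ) (V : Set (Fin d → ℕ)) : Prop where
  nonempty : V.Nonempty
  box : ∀ P ∈ V, ∀ i, 1 ≤ P i ∧ P i ≤ w i
  root_mem : w ∈ V
  /-- Every point different from the root has exactly one type. -/
  existsUnique_type : ∀ P ∈ V, P ≠ w → ∃! π : Direction d k, IsOfType V P π
  /-- For `1 ≤ l ≤ w i - 1`, the hyperplane `x_i = l` contains exactly one point whose type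
  contains `i`. -/
  hyperplane : ∀ (i : Fin d) (l : ℕ), 1 ≤ l → l < w i →
    ∃! P : Fin d → ℕ, P ∈ V ∧ P ≠ w ∧ P i = l ∧ ∃ π : Direction d k, IsOfType V P π ∧ i ∈ π.1
  /-- Two distinct points in a same affine space directed by the `e_i`, `i ∈ π`, are strictly
  comparable in all coordinates `i ∈ π`. -/
  affine : ∀ (π : Direction d k), ∀ P ∈ V, ∀ P' ∈ V, P ≠ P' → (∀ i, i ∉ π.1 → P i = P' i) →
    (∀ j ∈ π.1, P j > P' j) ∨ (∀ j ∈ π.1, P' j > P j)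

end NonAmbiguous

namespace NonAmbiguous

variable {d k : ℕ}

/-! A vertex is the word of directions leading up to the root, and both inverse constructions
recover this word from the points alone. In a NAT, completed components weakly decrease downwards,
strictly so in the coordinates of the index of the lower vertex. Below two different children of one
vertex, the coordinates in either index never agree again, since an integer component occurs at one
vertex only. As directions all have `k` elements, two vertices agreeing outside `π` must be
comparable, the lower one having index `π` (`exists_eq_cons`). This yields the geometric axioms and
shows that the parent is the least other point in the cone. Conversely, in a geometric NAT the
affine axiom gives the cone of a point along its type such a least point. Climbing from parent to
parent reaches the root, and the types met form a word; point and word determine each other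
(`isPath_unique_list`, `isPath_unique_point`). The hyperplane axiom then gives distinctness and the
interval condition. Injectivity follows because the word of a vertex is the path of its completed
label (`LabelledTree.IsNAT.isPath`). -/

theorem mem_cone_iff {P Q : Fin d → ℕ} {π : Direction d k} :
    Q ∈ cone P π ↔ (∀ i, i ∉ π.1 → Q i = P i) ∧ P ≤ Q := by
  have key : ∀ (a : Fin d → ℕ) (j : Fin d),
      (∑ i ∈ π.1, a i • (Pi.single i 1 : Fin d → ℕ)) j = if j ∈ π.1 then a j else 0 := by
    intro a j
    simp [Finset.sum_apply, Pi.single_apply]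
  constructor
  · rintro ⟨a, rfl⟩
    refine ⟨fun i hi => ?_, fun i => ?_⟩
    · rw [Pi.add_apply, key, if_neg hi, add_zero]
    · exact Nat.le_add_right _ _
  · rintro ⟨h1, h2⟩
    refine ⟨fun i => Q i - P i, funext fun j => ?_⟩
    rw [Pi.add_apply, key]
    have : P j ≤ Q j := h2 j
    split_ifs with hj
    · omega
    · rw [h1 j hj, add_zero]

theorem Direction.nonempty (hk : 1 ≤ k) (π : Direction d k) : π.1.Nonempty := by
  rw [← Finset.card_pos, π.2]; exact hk

theorem Direction.eq_of_subset {π ρ : Direction d k} (h : π.1 ⊆ ρ.1) : π = ρ :=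
  Subtype.ext (Finset.eq_of_subset_of_card_le h (by rw [π.2, ρ.2]))

/-- Two lists, none of which is a suffix of the other, branch at a common suffix. -/
theorem exists_branching {α : Type*} : ∀ {u v : List α}, ¬ u <:+ v → ¬ v <:+ u →
    ∃ m a b, a ≠ b ∧ a :: m <:+ u ∧ b :: m <:+ v
  | [], v, h, _ => absurd (List.nil_suffix) h
  | a :: u, v, h, h' => by
    by_cases hu : u <:+ v
    · obtain ⟨s, rfl⟩ := hu
      -- The last letter `b` of the prefix is the step by which the longer word leaves `u`; it
      -- differs from `a` by incomparability.
      rcases List.eq_nil_or_concat s with rfl | ⟨s, b, rfl⟩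
      · exact absurd (List.suffix_cons _ _) h'
      · have hb : b :: u <:+ s.concat b ++ u := ⟨s, by simp⟩
        refine ⟨u, a, b, ?_, List.suffix_refl _, hb⟩
        rintro rfl
        exact h hb
    · have hv : ¬ v <:+ u := fun hv => h' (hv.trans (List.suffix_cons _ _))
      obtain ⟨m, x, y, hxy, hx, hy⟩ := exists_branching hu hv
      exact ⟨m, x, y, hxy, hx.trans (List.suffix_cons _ _), hy⟩

/-- `Q` is the least point of `V`, different from `P`, in the cone of origin `P` and direction
`π`. -/
def IsParent (V : Set (Fin d → ℕ)) (P : Fin d → ℕ) (π : Direction d k) (Q : Fin d → ℕ) : Prop :=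
  (Q ∈ V ∧ Q ≠ P ∧ Q ∈ cone P π) ∧ ∀ R ∈ V, R ≠ P → R ∈ cone P π → Q ≤ R

/-- The successive types met when going from `P` up to the root `w` of `V` form the list `u`. -/
def IsPath (V : Set (Fin d → ℕ)) (w : Fin d → ℕ) : List (Direction d k) → (Fin d → ℕ) → Prop
  | [], P => P = w
  | π :: u, P => P ∈ V ∧ P ≠ w ∧ ∃ Q, IsParent V P π Q ∧ IsPath V w u Q

theorem IsParent.isOfType {V : Set (Fin d → ℕ)} {P Q : Fin d → ℕ} {π : Direction d k}
    (h : IsParent V P π Q) : IsOfType V P π := ⟨Q, h.1⟩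

theorem IsParent.unique {V : Set (Fin d → ℕ)} {P Q Q' : Fin d → ℕ} {π : Direction d k}
    (h : IsParent V P π Q) (h' : IsParent V P π Q') : Q = Q' :=
  le_antisymm (h.2 _ h'.1.1 h'.1.2.1 h'.1.2.2) (h'.2 _ h.1.1 h.1.2.1 h.1.2.2)

/-! ### Parents and paths in a geometric NAT -/

namespace IsGeometricNAT

variable {w : Fin d → ℕ} {V : Set (Fin d → ℕ)}

theorem finite (hV : IsGeometricNAT k w V) : V.Finite :=
  (Set.finite_Icc (1 : Fin d → ℕ) w).subset fun P hP =>
    ⟨fun i => (hV.box P hP i).1, fun i => (hV.box P hP i).2⟩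

theorem lt_of_isParent (hV : IsGeometricNAT k w V) {P Q : Fin d → ℕ} {π : Direction d k}
    (hP : P ∈ V) (h : IsParent V P π Q) {i : Fin d} (hi : i ∈ π.1) : P i < Q i := by
  obtain ⟨h1, h2⟩ := mem_cone_iff.1 h.1.2.2
  rcases hV.affine π Q h.1.1 P hP h.1.2.1 h1 with h3 | h3
  · exact h3 i hi
  · exact absurd (h3 i hi) (h2 i).not_gt

/-- The affine axiom makes the points of `V` in one cone a chain, so a point of minimal coordinate
sum is the least. -/
theorem exists_isParent (hk : 1 ≤ k) (hV : IsGeometricNAT k w V) {P : Fin d → ℕ}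
    {π : Direction d k} (h : IsOfType V P π) : ∃ Q, IsParent V P π Q := by
  obtain ⟨R, hR⟩ := h
  obtain ⟨Q, hQ, hmin⟩ := WellFounded.has_min (measure fun Q : Fin d → ℕ => ∑ i, Q i).wf
    {Q | Q ∈ V ∧ Q ≠ P ∧ Q ∈ cone P π} ⟨R, hR⟩
  refine ⟨Q, hQ, fun R hRV hRP hRc => ?_⟩
  by_cases hQR : Q = R
  · exact hQR.le
  have hQc := (mem_cone_iff.1 hQ.2.2).1
  have hRc' := (mem_cone_iff.1 hRc).1
  have hag : ∀ i, i ∉ π.1 → Q i = R i := fun i hi => (hQc i hi).trans (hRc' i hi).symm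
  rcases hV.affine π Q hQ.1 R hRV hQR hag with h | h
  · refine absurd ?_ (hmin R ⟨hRV, hRP, hRc⟩)
    obtain ⟨j, hj⟩ := π.nonempty hk
    refine Finset.sum_lt_sum (fun i _ => ?_) ⟨j, Finset.mem_univ _, h j hj⟩
    by_cases hi : i ∈ π.1
    · exact (h i hi).le
    · exact (hag i hi).ge
  · intro i
    by_cases hi : i ∈ π.1
    · exact (h i hi).le
    · exact (hag i hi).le

theorem mem_of_isPath (hV : IsGeometricNAT k w V) : ∀ {u : List (Direction d k)} {P : Fin d → ℕ},
    IsPath V w u P → P ∈ V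
  | [], _, h => by rw [show _ = w from h]; exact hV.root_mem
  | _ :: _, _, h => h.1

theorem exists_isPath (hk : 1 ≤ k) (hV : IsGeometricNAT k w V) {P : Fin d → ℕ} (hP : P ∈ V) :
    ∃ u : List (Direction d k), IsPath V w u P := by
  -- The `ℓ¹` distance to the root drops when passing to the parent.
  induction hn : ∑ i, (w i - P i) using Nat.strong_induction_on generalizing P with
  | _ n ih =>
    by_cases hPw : P = w
    · exact ⟨[], hPw⟩
    obtain ⟨π, hπ, -⟩ := hV.existsUnique_type P hP hPw
    obtain ⟨Q, hQ⟩ := hV.exists_isParent hk hπ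
    obtain ⟨u, hu⟩ := ih (∑ i, (w i - Q i)) (by
      rw [← hn]
      obtain ⟨j, hj⟩ := π.nonempty hk
      refine Finset.sum_lt_sum (fun i _ => Nat.sub_le_sub_left ((mem_cone_iff.1 hQ.1.2.2).2 i) _)
        ⟨j, Finset.mem_univ _, ?_⟩
      have h1 := hV.lt_of_isParent hP hQ hj
      have h2 := (hV.box Q hQ.1.1 j).2
      omega) hQ.1.1 rfl
    exact ⟨π :: u, hP, hPw, Q, hQ, hu⟩

theorem isPath_unique_list (hV : IsGeometricNAT k w V) : ∀ {u v : List (Direction d k)}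
    {P : Fin d → ℕ}, IsPath V w u P → IsPath V w v P → u = v
  | [], [], _, _, _ => rfl
  | [], _ :: _, _, h, h' => absurd h h'.2.1
  | _ :: _, [], _, h, h' => absurd h' h.2.1
  | π :: u, ρ :: v, P, ⟨hP, hw, Q, hQ, hu⟩, ⟨_, _, R, hR, hv⟩ => by
    obtain rfl := (hV.existsUnique_type P hP hw).unique hQ.isOfType hR.isOfType
    obtain rfl := hQ.unique hR
    rw [isPath_unique_list hV hu hv]

/-- Two children of `Q` along `π` would be comparable; the larger would lie in the cone of the
smaller without dominating `Q`, against the minimality of `Q`. -/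
theorem isPath_unique_point (hk : 1 ≤ k) (hV : IsGeometricNAT k w V) :
    ∀ {u : List (Direction d k)} {P P' : Fin d → ℕ}, IsPath V w u P → IsPath V w u P' → P = P'
  | [], _, _, h, h' => Eq.trans h (Eq.symm h')
  | π :: u, P, P', ⟨hP, hw, Q, hQ, hu⟩, ⟨hP', hw', Q', hQ', hu'⟩ => by
    obtain rfl := isPath_unique_point hk hV hu hu'
    have hQc := (mem_cone_iff.1 hQ.1.2.2).1
    have hQc' := (mem_cone_iff.1 hQ'.1.2.2).1
    obtain ⟨j, hj⟩ := π.nonempty hk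
    have main : ∀ {P P' : Fin d → ℕ}, P ∈ V → P' ∈ V → IsParent V P π Q → IsParent V P' π Q →
        P ≠ P' → (∀ i, i ∉ π.1 → P i = P' i) → ¬ ∀ i ∈ π.1, P i > P' i := by
      intro P P' hP hP' hQ hQ' hne hag hlt
      refine (hV.lt_of_isParent hP hQ hj).not_ge (hQ'.2 P hP hne
        (mem_cone_iff.2 ⟨hag, fun i => ?_⟩) j)
      by_cases hi : i ∈ π.1
      · exact (hlt i hi).le
      · exact (hag i hi).ge
    by_contra hne
    have hag : ∀ i, i ∉ π.1 → P i = P' i := fun i hi => (hQc i hi).symm.trans (hQc' i hi)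
    rcases hV.affine π P hP P' hP' hne hag with h | h
    · exact main hP hP' hQ hQ' hne hag h
    · exact main hP' hP hQ' hQ (Ne.symm hne) (fun i hi => (hag i hi).symm) h

theorem le_of_suffix (hk : 1 ≤ k) (hV : IsGeometricNAT k w V) : ∀ {u v : List (Direction d k)}
    {P Q : Fin d → ℕ}, IsPath V w u P → IsPath V w v Q → v <:+ u → P ≤ Q
  | [], v, P, Q, hu, hv, h => by
    obtain rfl := List.suffix_nil.1 h
    exact (hV.isPath_unique_point hk hu hv).le
  | π :: u, v, P, Q, hu, hv, h => by
    rcases List.suffix_cons_iff.1 h with rfl | h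
    · exact (hV.isPath_unique_point hk hu hv).le
    · obtain ⟨_, _, R, hR, hRu⟩ := hu
      exact (mem_cone_iff.1 hR.1.2.2).2.trans (le_of_suffix hk hV hRu hv h)

end IsGeometricNAT

/-- The label of the vertex `u` has an integer component of index `i`. -/
def Carries (i : Fin d) : List (Direction d k) → Prop
  | [] => True
  | π :: _ => i ∈ π.1

open Classical in
/-- The tree of the points of `V`, where `P` is the child of index its type of its parent. -/
noncomputable def treeOf (V : Set (Fin d → ℕ)) (w : Fin d → ℕ)
    (hfin : {u : List (Direction d k) | ∃ P, IsPath V w u P}.Finite) : LabelledTree d k where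
  verts := hfin.toFinset
  root_mem := by
    rw [Set.Finite.mem_toFinset]
    exact ⟨w, rfl⟩
  parent_mem := by
    intro π u h
    rw [Set.Finite.mem_toFinset] at h ⊢
    obtain ⟨P, _, _, Q, _, hQ⟩ := h
    exact ⟨Q, hQ⟩
  label u i := if Carries i u.1 then some ((hfin.mem_toFinset.1 u.2).choose i) else none

/-! ### The tree of a geometric NAT -/

namespace IsGeometricNAT

variable {w : Fin d → ℕ} {V : Set (Fin d → ℕ)}

theorem finite_paths (hV : IsGeometricNAT k w V) :
    {u : List (Direction d k) | ∃ P, IsPath V w u P}.Finite := by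
  refine (hV.finite.biUnion (t := fun P => {u : List (Direction d k) | IsPath V w u P})
    fun P _ => Set.Subsingleton.finite fun u hu v hv => hV.isPath_unique_list hu hv).subset ?_
  rintro u ⟨P, hP⟩
  exact Set.mem_biUnion (hV.mem_of_isPath hP) hP

theorem lt_of_carries (hV : IsGeometricNAT k w V) {π : Direction d k} {u : List (Direction d k)}
    {P : Fin d → ℕ} {i : Fin d}
    (hP : IsPath V w (π :: u) P) (hi : i ∈ π.1) : P i < w i := by
  obtain ⟨hPV, _, Q, hQ, _⟩ := hP
  exact (hV.lt_of_isParent hPV hQ hi).trans_le (hV.box Q hQ.1.1 i).2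

/-- Below level `w i` this is the uniqueness in the hyperplane axiom; at level `w i` only the root
carries `i`, by `lt_of_carries`. -/
theorem path_eq_of_carries (hV : IsGeometricNAT k w V) {u v : List (Direction d k)}
    {P Q : Fin d → ℕ} {i : Fin d}
    (hP : IsPath V w u P) (hQ : IsPath V w v Q) (hu : Carries i u) (hv : Carries i v)
    (h : P i = Q i) : u = v := by
  cases u with
  | nil =>
    cases v with
    | nil => rfl
    | cons ρ v =>
      rw [show P = w from hP] at h
      exact absurd h (hV.lt_of_carries hQ hv).ne'
  | cons π u =>
    cases v with
    | nil =>
      rw [show Q = w from hQ] at h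
      exact absurd h (hV.lt_of_carries hP hu).ne
    | cons ρ v =>
      have hPV := hV.mem_of_isPath hP
      have hlt := hV.lt_of_carries hP hu
      obtain rfl : P = Q := by
        obtain ⟨_, hPw, P', hP', _⟩ := hP
        obtain ⟨hQV, hQw, Q', hQ', _⟩ := hQ
        exact (hV.hyperplane i (P i) (hV.box P hPV i).1 hlt).unique
          ⟨hPV, hPw, rfl, π, hP'.isOfType, hu⟩ ⟨hQV, hQw, h.symm, ρ, hQ'.isOfType, hv⟩
      exact hV.isPath_unique_list hP hQ

theorem mem_verts (hV : IsGeometricNAT k w V) {u : List (Direction d k)} :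
    u ∈ (treeOf V w hV.finite_paths).verts ↔ ∃ P, IsPath V w u P :=
  hV.finite_paths.mem_toFinset

theorem label_of_carries (hk : 1 ≤ k) (hV : IsGeometricNAT k w V) {u : List (Direction d k)}
    {P : Fin d → ℕ} {i : Fin d}
    (hP : IsPath V w u P) (hu : u ∈ (treeOf V w hV.finite_paths).verts) (hi : Carries i u) :
    (treeOf V w hV.finite_paths).label ⟨u, hu⟩ i = some (P i) := by
  have h := (hV.finite_paths.mem_toFinset.1 hu).choose_spec
  simp only [treeOf, if_pos hi]
  rw [hV.isPath_unique_point hk h hP]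

theorem label_of_not_carries (hV : IsGeometricNAT k w V) {u : List (Direction d k)} {i : Fin d}
    (hu : u ∈ (treeOf V w hV.finite_paths).verts) (hi : ¬ Carries i u) :
    (treeOf V w hV.finite_paths).label ⟨u, hu⟩ i = none := by
  simp only [treeOf, if_neg hi]

theorem label_eq_some_iff (hk : 1 ≤ k) (hV : IsGeometricNAT k w V) {u : List (Direction d k)}
    {P : Fin d → ℕ} {i : Fin d} {a : ℕ}
    (hP : IsPath V w u P) (hu : u ∈ (treeOf V w hV.finite_paths).verts) :
    (treeOf V w hV.finite_paths).label ⟨u, hu⟩ i = some a ↔ Carries i u ∧ P i = a := by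
  by_cases hi : Carries i u
  · simp [hV.label_of_carries hk hP hu hi, hi]
  · simp [hV.label_of_not_carries hu hi, hi]

theorem completedLabel_eq (hk : 1 ≤ k) (hV : IsGeometricNAT k w V) :
    ∀ {u : List (Direction d k)} {P : Fin d → ℕ} (_ : IsPath V w u P)
    (hu : u ∈ (treeOf V w hV.finite_paths).verts),
    (treeOf V w hV.finite_paths).completedLabel u hu = P
  | [], P, hP, hu => by
    funext i
    simp [LabelledTree.completedLabel, hV.label_of_carries hk hP hu (i := i) trivial]
  | π :: u, P, hP, hu => by
    funext i
    rw [LabelledTree.completedLabel]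
    by_cases hi : Carries i (π :: u)
    · simp [hV.label_of_carries hk hP hu hi]
    · obtain ⟨_, _, Q, hQ, hQu⟩ := hP
      rw [hV.label_of_not_carries hu hi, completedLabel_eq hk hV hQu]
      exact (mem_cone_iff.1 hQ.1.2.2).1 i hi

theorem pointSet_treeOf (hk : 1 ≤ k) (hV : IsGeometricNAT k w V) :
    (treeOf V w hV.finite_paths).pointSet = V := by
  ext P
  constructor
  · rintro ⟨u, hu, rfl⟩
    obtain ⟨P, hP⟩ := hV.mem_verts.1 hu
    rw [hV.completedLabel_eq hk hP]
    exact hV.mem_of_isPath hP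
  · intro hP
    obtain ⟨u, hu⟩ := hV.exists_isPath hk hP
    have hu' := hV.mem_verts.2 ⟨P, hu⟩
    exact ⟨u, hu', (hV.completedLabel_eq hk hu hu').symm⟩

theorem hasGeometricSize_treeOf (hk : 1 ≤ k) (hV : IsGeometricNAT k w V) :
    (treeOf V w hV.finite_paths).HasGeometricSize w :=
  fun _ => hV.label_of_carries hk (u := []) rfl _ trivial

theorem components_treeOf (hk : 1 ≤ k) (hV : IsGeometricNAT k w V) (i : Fin d) :
    (treeOf V w hV.finite_paths).components i = Set.Icc 1 (w i) := by
  ext a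
  constructor
  · rintro ⟨⟨u, hu⟩, h⟩
    obtain ⟨P, hP⟩ := hV.mem_verts.1 hu
    obtain ⟨-, rfl⟩ := (hV.label_eq_some_iff hk hP hu).1 h
    exact hV.box P (hV.mem_of_isPath hP) i
  · rintro ⟨h1, h2⟩
    rcases h2.lt_or_eq with h2 | rfl
    · obtain ⟨P, ⟨hP, hPw, rfl, π, hπ, hi⟩, -⟩ := hV.hyperplane i a h1 h2
      obtain ⟨Q, hQ⟩ := hV.exists_isParent hk hπ
      obtain ⟨u, hu⟩ := hV.exists_isPath hk hQ.1.1
      have hp : IsPath V w (π :: u) P := ⟨hP, hPw, Q, hQ, hu⟩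
      exact ⟨⟨π :: u, hV.mem_verts.2 ⟨P, hp⟩⟩, hV.label_of_carries hk hp _ hi⟩
    · exact ⟨LabelledTree.root _, hV.hasGeometricSize_treeOf hk i⟩

theorem isNAT_treeOf (hk : 1 ≤ k) (hV : IsGeometricNAT k w V) :
    (treeOf V w hV.finite_paths).IsNAT where
  root_label i := by rw [hV.hasGeometricSize_treeOf hk i]; rfl
  child_label π u h i := by
    by_cases hi : i ∈ π.1
    · obtain ⟨P, hP⟩ := hV.mem_verts.1 h
      simp [hV.label_of_carries hk hP h (i := i) hi, hi]
    · simp [hV.label_of_not_carries h (i := i) hi, hi]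
  growth := by
    rintro ⟨u, hu⟩ ⟨v, hv⟩ ⟨hne, hsuf⟩ i a b ha hb
    obtain ⟨P, hP⟩ := hV.mem_verts.1 hu
    obtain ⟨Q, hQ⟩ := hV.mem_verts.1 hv
    obtain ⟨hu', rfl⟩ := (hV.label_eq_some_iff hk hP hu).1 ha
    obtain ⟨hv', rfl⟩ := (hV.label_eq_some_iff hk hQ hv).1 hb
    -- Equality is excluded because one level of `i` is carried by one path only.
    refine lt_of_le_of_ne (hV.le_of_suffix hk hP hQ hsuf i) fun h => hne ?_
    exact Subtype.ext (hV.path_eq_of_carries hP hQ hu' hv' h)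
  distinct := by
    rintro ⟨u, hu⟩ ⟨v, hv⟩ hne i a b ha hb h
    obtain ⟨P, hP⟩ := hV.mem_verts.1 hu
    obtain ⟨Q, hQ⟩ := hV.mem_verts.1 hv
    obtain ⟨hu', rfl⟩ := (hV.label_eq_some_iff hk hP hu).1 ha
    obtain ⟨hv', rfl⟩ := (hV.label_eq_some_iff hk hQ hv).1 hb
    exact hne (Subtype.ext (hV.path_eq_of_carries hP hQ hu' hv' h))
  interval i := by
    rw [hV.components_treeOf hk i]
    exact ⟨Set.ordConnected_Icc, isLeast_Icc (hV.box w hV.root_mem i).1⟩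

end IsGeometricNAT

/-! ### Completed labels of a NAT -/

namespace LabelledTree

variable {T : LabelledTree d k}

theorem mem_of_suffix {u v : List (Direction d k)} (hu : u ∈ T.verts) (h : v <:+ u) :
    v ∈ T.verts := by
  induction u with
  | nil => rwa [List.suffix_nil.1 h]
  | cons π u ih =>
    rcases List.suffix_cons_iff.1 h with rfl | h
    · exact hu
    · exact ih (T.parent_mem hu) h

/-- If the label of an ancestor `c` of `u` has an integer component of index `i`, then that
component of the completed label of `u` comes from a vertex between `u` and `c`. -/
theorem exists_label_eq_completedLabel {c u : List (Direction d k)} (hu : u ∈ T.verts)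
    (hc : c ∈ T.verts) (h : c <:+ u) {i : Fin d} (hi : (T.label ⟨c, hc⟩ i).isSome) :
    ∃ (v : List (Direction d k)) (hv : v ∈ T.verts), c <:+ v ∧ v <:+ u ∧
      T.label ⟨v, hv⟩ i = some (T.completedLabel u hu i) := by
  obtain ⟨a, ha⟩ := Option.isSome_iff_exists.1 hi
  induction u with
  | nil =>
    obtain rfl := List.suffix_nil.1 h
    exact ⟨[], hc, h, h, by simp [completedLabel, ha]⟩
  | cons π u ih =>
    rcases hl : T.label ⟨π :: u, hu⟩ i with _ | b
    · rcases List.suffix_cons_iff.1 h with rfl | h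
      · simp [hl] at ha
      · obtain ⟨v, hv, h1, h2, h3⟩ := ih (T.parent_mem hu) h
        exact ⟨v, hv, h1, h2.trans (List.suffix_cons _ _), by simp [completedLabel, hl, h3]⟩
    · exact ⟨π :: u, hu, h, List.suffix_refl _, by simp [completedLabel, hl]⟩

namespace IsNAT

theorem label_cons (hT : T.IsNAT) {π : Direction d k} {u : List (Direction d k)}
    (hu : π :: u ∈ T.verts) {i : Fin d} (hi : i ∈ π.1) :
    T.label ⟨π :: u, hu⟩ i = some (T.completedLabel (π :: u) hu i) := by
  obtain ⟨a, ha⟩ := Option.isSome_iff_exists.1 ((hT.child_label π u hu i).2 hi)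
  simp [completedLabel, ha]

theorem label_cons_of_notMem (hT : T.IsNAT) {π : Direction d k} {u : List (Direction d k)}
    (hu : π :: u ∈ T.verts) {i : Fin d} (hi : i ∉ π.1) : T.label ⟨π :: u, hu⟩ i = none := by
  rw [← Option.not_isSome_iff_eq_none, hT.child_label π u hu i]
  exact hi

theorem exists_label_eq (hT : T.IsNAT) {u : List (Direction d k)} (hu : u ∈ T.verts) (i : Fin d) :
    ∃ (v : List (Direction d k)) (hv : v ∈ T.verts), v <:+ u ∧
      T.label ⟨v, hv⟩ i = some (T.completedLabel u hu i) := by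
  obtain ⟨v, hv, -, h⟩ :=
    exists_label_eq_completedLabel hu T.root_mem List.nil_suffix (hT.root_label i)
  exact ⟨v, hv, h⟩

theorem completedLabel_cons_of_notMem (hT : T.IsNAT) {π : Direction d k}
    {u : List (Direction d k)} (hu : π :: u ∈ T.verts) {i : Fin d} (hi : i ∉ π.1) :
    T.completedLabel (π :: u) hu i = T.completedLabel u (T.parent_mem hu) i := by
  simp [completedLabel, hT.label_cons_of_notMem hu hi]

theorem completedLabel_cons_lt (hT : T.IsNAT) {π : Direction d k} {u v : List (Direction d k)}
    (hu : π :: u ∈ T.verts) (hv : v ∈ T.verts) (h : v <:+ u) {i : Fin d} (hi : i ∈ π.1) :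
    T.completedLabel (π :: u) hu i < T.completedLabel v hv i := by
  obtain ⟨x, hx, hxv, hlab⟩ := hT.exists_label_eq hv i
  have hxu := hxv.trans h
  refine hT.growth ⟨π :: u, hu⟩ ⟨x, hx⟩ ⟨fun he => ?_, hxu.trans (List.suffix_cons _ _)⟩ i _ _
    (hT.label_cons hu hi) hlab
  -- Otherwise `π :: u` would be a suffix of `u`.
  obtain rfl := congrArg Subtype.val he
  have := hxu.length_le
  simp at this

theorem completedLabel_cons_le (hT : T.IsNAT) {π : Direction d k} {u : List (Direction d k)}
    (hu : π :: u ∈ T.verts) :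
    T.completedLabel (π :: u) hu ≤ T.completedLabel u (T.parent_mem hu) := by
  intro i
  by_cases hi : i ∈ π.1
  · exact (hT.completedLabel_cons_lt hu (T.parent_mem hu) (List.suffix_refl _) hi).le
  · exact (hT.completedLabel_cons_of_notMem hu hi).le

theorem completedLabel_le (hT : T.IsNAT) {u v : List (Direction d k)} (hu : u ∈ T.verts)
    (hv : v ∈ T.verts) (h : v <:+ u) : T.completedLabel u hu ≤ T.completedLabel v hv := by
  induction u with
  | nil =>
    obtain rfl := List.suffix_nil.1 h
    exact le_rfl
  | cons π u ih =>
    rcases List.suffix_cons_iff.1 h with rfl | h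
    · exact le_rfl
    · exact (hT.completedLabel_cons_le hu).trans (ih (T.parent_mem hu) h)

/-- The component at `u` comes from a vertex at or below `π :: m`. Were the values equal, that
vertex would also be an ancestor of `v` or `v` itself, which lies below `ρ :: m`. -/
theorem completedLabel_ne_of_branching (hT : T.IsNAT) {m u v : List (Direction d k)}
    {π ρ : Direction d k} (hu : u ∈ T.verts) (hv : v ∈ T.verts) (hne : π ≠ ρ)
    (hπ : π :: m <:+ u) (hρ : ρ :: m <:+ v) {i : Fin d} (hi : i ∈ π.1) :
    T.completedLabel u hu i ≠ T.completedLabel v hv i := by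
  intro h
  have hc := mem_of_suffix hu hπ
  obtain ⟨x, hx, hcx, -, hlx⟩ :=
    exists_label_eq_completedLabel hu hc hπ ((hT.child_label π m hc i).2 hi)
  obtain ⟨y, hy, hyv, hly⟩ := hT.exists_label_eq hv i
  have hxy : x = y := by
    by_contra hxy
    exact hT.distinct ⟨x, hx⟩ ⟨y, hy⟩ (fun he => hxy (congrArg Subtype.val he)) i _ _ hlx hly h
  subst hxy
  have h1 := List.suffix_of_suffix_length_le (hcx.trans hyv) hρ (by simp)
  have h2 := h1.eq_of_length (by simp)
  exact hne (List.cons.inj h2).1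

/-- If the completed labels of two vertices agree outside a direction `π`, then one of them is a
proper descendant of the other, and is of index `π`. -/
theorem exists_eq_cons (hT : T.IsNAT) {u v : List (Direction d k)} (hu : u ∈ T.verts)
    (hv : v ∈ T.verts) (hne : u ≠ v) {π : Direction d k}
    (h : ∀ i, i ∉ π.1 → T.completedLabel u hu i = T.completedLabel v hv i) :
    (∃ s, u = π :: s ∧ v <:+ s) ∨ (∃ s, v = π :: s ∧ u <:+ s) := by
  have main : ∀ {u v : List (Direction d k)} (hu : u ∈ T.verts) (hv : v ∈ T.verts), u ≠ v →
      (∀ i, i ∉ π.1 → T.completedLabel u hu i = T.completedLabel v hv i) → v <:+ u →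
      ∃ s, u = π :: s ∧ v <:+ s := by
    intro u v hu hv hne h hvu
    cases u with
    | nil => exact absurd (List.suffix_nil.1 hvu).symm hne
    | cons ρ s =>
      rcases List.suffix_cons_iff.1 hvu with rfl | hvs
      · exact absurd rfl hne
      have hρ : ρ = π := Direction.eq_of_subset fun i hi => by
        by_contra hiπ
        exact (hT.completedLabel_cons_lt hu hv hvs hi).ne (h i hiπ)
      exact ⟨s, by rw [hρ], hvs⟩
  by_cases h1 : v <:+ u
  · exact Or.inl (main hu hv hne h h1)
  by_cases h2 : u <:+ v
  · exact Or.inr (main hv hu hne.symm (fun i hi => (h i hi).symm) h2)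
  -- Both branching indices must be contained in `π`, hence equal to it by cardinality.
  obtain ⟨m, a, b, hab, ha, hb⟩ := exists_branching h2 h1
  have ha' : a = π := Direction.eq_of_subset fun i hi => by
    by_contra hiπ
    exact hT.completedLabel_ne_of_branching hu hv hab ha hb hi (h i hiπ)
  have hb' : b = π := Direction.eq_of_subset fun i hi => by
    by_contra hiπ
    exact hT.completedLabel_ne_of_branching hv hu hab.symm hb ha hi (h i hiπ).symm
  exact absurd (ha'.trans hb'.symm) hab

theorem exists_eq_cons_of_mem_cone (hT : T.IsNAT) (hk : 1 ≤ k) {u v : List (Direction d k)}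
    (hu : u ∈ T.verts)
    (hv : v ∈ T.verts) {π : Direction d k} (hne : T.completedLabel v hv ≠ T.completedLabel u hu)
    (h : T.completedLabel v hv ∈ cone (T.completedLabel u hu) π) : ∃ s, u = π :: s ∧ v <:+ s := by
  obtain ⟨h1, h2⟩ := mem_cone_iff.1 h
  have huv : u ≠ v := by rintro rfl; exact hne rfl
  rcases hT.exists_eq_cons hu hv huv (fun i hi => (h1 i hi).symm) with h | ⟨s, rfl, hs⟩
  · exact h
  · obtain ⟨j, hj⟩ := π.nonempty hk
    exact absurd (h2 j) (hT.completedLabel_cons_lt hv hu hs hj).not_ge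

theorem completedLabel_cons_ne (hT : T.IsNAT) (hk : 1 ≤ k) {π : Direction d k}
    {u v : List (Direction d k)}
    (hu : π :: u ∈ T.verts) (hv : v ∈ T.verts) (h : v <:+ u) :
    T.completedLabel v hv ≠ T.completedLabel (π :: u) hu := by
  obtain ⟨j, hj⟩ := π.nonempty hk
  exact fun he => (hT.completedLabel_cons_lt hu hv h hj).ne' (congrFun he j)

theorem isParent (hT : T.IsNAT) (hk : 1 ≤ k) {π : Direction d k} {u : List (Direction d k)}
    (hu : π :: u ∈ T.verts) :
    IsParent T.pointSet (T.completedLabel (π :: u) hu) π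
      (T.completedLabel u (T.parent_mem hu)) := by
  refine ⟨⟨⟨u, _, rfl⟩, hT.completedLabel_cons_ne hk hu _ (List.suffix_refl _), mem_cone_iff.2
    ⟨fun i hi => (hT.completedLabel_cons_of_notMem hu hi).symm, hT.completedLabel_cons_le hu⟩⟩, ?_⟩
  rintro _ ⟨v, hv, rfl⟩ hne hc
  obtain ⟨s, hs, hvs⟩ := hT.exists_eq_cons_of_mem_cone hk hu hv hne hc
  obtain rfl := (List.cons.inj hs).2
  exact hT.completedLabel_le _ _ hvs

theorem exists_eq_cons_of_isOfType (hT : T.IsNAT) (hk : 1 ≤ k) {π : Direction d k}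
    {u : List (Direction d k)}
    (hu : u ∈ T.verts) (h : IsOfType T.pointSet (T.completedLabel u hu) π) :
    ∃ s, u = π :: s := by
  obtain ⟨_, ⟨v, hv, rfl⟩, hne, hc⟩ := h
  obtain ⟨s, hs, -⟩ := hT.exists_eq_cons_of_mem_cone hk hu hv hne hc
  exact ⟨s, hs⟩

/-! ### The geometric axioms and injectivity -/

variable {w : Fin d → ℕ}

theorem completedLabel_nil (hw : T.HasGeometricSize w) (h : [] ∈ T.verts) :
    T.completedLabel [] h = w := by
  funext i
  simp [completedLabel, show T.label ⟨[], h⟩ i = some (w i) from hw i]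

theorem isGeometricNAT (hT : T.IsNAT) (hk : 1 ≤ k) (hw : T.HasGeometricSize w) :
    IsGeometricNAT k w T.pointSet where
  nonempty := ⟨_, [], T.root_mem, rfl⟩
  box := by
    rintro _ ⟨u, hu, rfl⟩ i
    refine ⟨?_, ?_⟩
    · obtain ⟨v, hv, -, hlab⟩ := hT.exists_label_eq hu i
      exact (hT.interval i).2.2 ⟨⟨v, hv⟩, hlab⟩
    · have := hT.completedLabel_le hu T.root_mem List.nil_suffix i
      rwa [completedLabel_nil hw] at this
  root_mem := ⟨[], T.root_mem, (completedLabel_nil hw _).symm⟩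
  existsUnique_type := by
    rintro _ ⟨u, hu, rfl⟩ hne
    cases u with
    | nil => exact absurd (completedLabel_nil hw _) hne
    | cons π u =>
      refine ⟨π, (hT.isParent hk hu).isOfType, fun ρ hρ => ?_⟩
      obtain ⟨s, hs⟩ := hT.exists_eq_cons_of_isOfType hk hu hρ
      exact (List.cons.inj hs).1.symm
  hyperplane := by
    intro i l h1 h2
    obtain ⟨⟨u, hu⟩, hlab⟩ : l ∈ T.components i :=
      (hT.interval i).1.out (hT.interval i).2.1 ⟨T.root, hw i⟩ ⟨h1, h2.le⟩
    cases u with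
    | nil =>
      have := (hw i).symm.trans hlab
      exact absurd (Option.some.inj this) h2.ne'
    | cons π u =>
      have hi : i ∈ π.1 := (hT.child_label π u hu i).1 (by simp [hlab])
      have hl : T.completedLabel (π :: u) hu i = l :=
        Option.some.inj ((hT.label_cons hu hi).symm.trans hlab)
      refine ⟨T.completedLabel (π :: u) hu, ⟨⟨_, hu, rfl⟩, ?_, hl, π,
        (hT.isParent hk hu).isOfType, hi⟩, ?_⟩
      · intro h
        rw [h] at hl
        exact h2.ne' hl
      · rintro _ ⟨⟨v, hv, rfl⟩, -, hl', ρ, hρ, hiρ⟩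
        obtain ⟨s, rfl⟩ := hT.exists_eq_cons_of_isOfType hk hv hρ
        by_cases h : (⟨ρ :: s, hv⟩ : {u // u ∈ T.verts}) = ⟨π :: u, hu⟩
        · cases h; rfl
        · exact absurd (hl'.trans hl.symm)
            (hT.distinct _ _ h i _ _ (hT.label_cons hv hiρ) (hT.label_cons hu hi))
  affine := by
    rintro π _ ⟨u, hu, rfl⟩ _ ⟨v, hv, rfl⟩ hne h
    have huv : u ≠ v := by rintro rfl; exact hne rfl
    rcases hT.exists_eq_cons hu hv huv h with ⟨s, rfl, hs⟩ | ⟨s, rfl, hs⟩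
    · exact Or.inr fun j hj => hT.completedLabel_cons_lt hu hv hs hj
    · exact Or.inl fun j hj => hT.completedLabel_cons_lt hv hu hs hj

theorem isPath (hT : T.IsNAT) (hk : 1 ≤ k) (hw : T.HasGeometricSize w) {u : List (Direction d k)}
    (hu : u ∈ T.verts) : IsPath T.pointSet w u (T.completedLabel u hu) := by
  induction u with
  | nil => exact completedLabel_nil hw hu
  | cons π u ih =>
    refine ⟨⟨_, hu, rfl⟩, ?_, _, hT.isParent hk hu, ih (T.parent_mem hu)⟩
    rw [← completedLabel_nil hw T.root_mem]
    exact (hT.completedLabel_cons_ne hk hu T.root_mem List.nil_suffix).symm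

theorem mem_verts_iff (hT : T.IsNAT) (hk : 1 ≤ k) (hw : T.HasGeometricSize w)
    {u : List (Direction d k)} :
    u ∈ T.verts ↔ ∃ P, IsPath T.pointSet w u P := by
  refine ⟨fun hu => ⟨_, hT.isPath hk hw hu⟩, ?_⟩
  rintro ⟨P, hP⟩
  have hV := hT.isGeometricNAT hk hw
  obtain ⟨v, hv, rfl⟩ := hV.mem_of_isPath hP
  rwa [hV.isPath_unique_list hP (hT.isPath hk hw hv)]

/-- The point set determines the paths, hence the vertices and their completed labels; the index of
a vertex then tells which components are replaced by `•`. -/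
theorem eq_of_pointSet_eq (hk : 1 ≤ k) {T T' : LabelledTree d k} (hT : T.IsNAT)
    (hw : T.HasGeometricSize w)
    (hT' : T'.IsNAT) (hw' : T'.HasGeometricSize w) (h : T.pointSet = T'.pointSet) : T = T' := by
  have hverts : T.verts = T'.verts := by
    ext u
    rw [hT.mem_verts_iff hk hw, hT'.mem_verts_iff hk hw', h]
  have hcomp : ∀ u (hu : u ∈ T.verts) (hu' : u ∈ T'.verts),
      T.completedLabel u hu = T'.completedLabel u hu' := fun u hu hu' =>
    (hT'.isGeometricNAT hk hw').isPath_unique_point hk (h ▸ hT.isPath hk hw hu)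
      (hT'.isPath hk hw' hu')
  have hlabel : ∀ u (hu : u ∈ T.verts) (hu' : u ∈ T'.verts),
      T.label ⟨u, hu⟩ = T'.label ⟨u, hu'⟩ := by
    intro u hu hu'
    funext i
    cases u with
    | nil => exact (hw i).trans (hw' i).symm
    | cons π u =>
      by_cases hi : i ∈ π.1
      · rw [hT.label_cons hu hi, hT'.label_cons hu' hi, hcomp _ hu hu']
      · rw [hT.label_cons_of_notMem hu hi, hT'.label_cons_of_notMem hu' hi]
  obtain ⟨verts, _, _, label⟩ := T
  obtain ⟨verts', _, _, label'⟩ := T'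
  obtain rfl : verts = verts' := hverts
  obtain rfl : label = label' := funext fun u => hlabel u.1 u.2 u.2
  rfl

end IsNAT

end LabelledTree

end NonAmbiguous

theorem mainTheorem11 (d k : ℕ) (hk : 1 ≤ k) (hkd : k ≤ d) (w : Fin d → ℕ) :
    Set.BijOn (fun T : NonAmbiguous.LabelledTree d k => T.pointSet)
      {T : NonAmbiguous.LabelledTree d k | T.IsNAT ∧ T.HasGeometricSize w}
      {V : Set (Fin d → ℕ) | NonAmbiguous.IsGeometricNAT k w V} := by
  refine ⟨fun T hT => hT.1.isGeometricNAT hk hT.2, fun T hT T' hT' h =>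
    NonAmbiguous.LabelledTree.IsNAT.eq_of_pointSet_eq hk hT.1 hT.2 hT'.1 hT'.2 h, fun V hV => ?_⟩
  have hV : NonAmbiguous.IsGeometricNAT k w V := hV
  exact ⟨NonAmbiguous.treeOf V w hV.finite_paths,
    ⟨hV.isNAT_treeOf hk, hV.hasGeometricSize_treeOf hk⟩, hV.pointSet_treeOf hk⟩
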